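/- Let $G$ be a countable (discrete) group. For $m\ge 1$, a map $\sigma:G\to\mathrm{Sym}(m)$ (not necessarily a homomorphism), and $F\subset G$, let $V(F)\subset\{1,\dots,m\}$ be the set of all $v$ such that for all $f_1,f_2\in F$ one has $\sigma(f_1)\sigma(f_2)v=\sigma(f_1f_2)v$, and $\sigma(f_1)v\ne\sigma(f_2)v$ if $f_1\neq f_2$. The group $G$ is sofic if there are maps $\sigma_i:G\to\mathrm{Sym}(m_i)$ with $m_i\ge 1$ $(i=1,2,\dots)$, subsets $F_1\subset F_2\subset\cdots$ of $G$ with $\bigcup_i F_i=G$, and real numbers $\epsilon_i\to 0$ such that $|V(F_i)|\ge(1-\epsilon_i)m_i$ for all $i$, where $V(F_i)$ is formed with $\sigma_i$. For a standard Borel probability space $(K,\kappa)$, the entropy of $\kappa$ is $H(\kappa)=-\sum_{k\in K'}\kappa(\{k\})\log\kappa(\{k\})\in[0,\infty]$ (with $0\log 0=0$) if there is a finite or countably infinite set $K'\subset K$ with $\kappa(K')=1$, and $H(\kappa)=+\infty$ otherwise. The Bernoulli shift $(G,K^G,\kappa^G)$ is the set $K^G$ of all functions $x:G\to K$ with the product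 Borel structure and the product measure $\kappa^G$, on which $G$ acts by $(gx)(f)=x(g^{-1}f)$. Two systems $(G,X,\mu)$ and $(G,Y,\nu)$ are isomorphic if there are conull sets $X'\subset X$, $Y'\subset Y$ and a bijective measurable map $\phi:X'\to Y'$ with measurable inverse such that $\phi_*\mu=\nu$ and, for all $g\in G$ and $x\in X'$, $gx\in X'$ and $\phi(gx)=g\phi(x)$. Theorem. Let $G$ be a countable sofic group and let $(K_1,\kappa_1)$, $(K_2,\kappa_2)$ be standard Borel probability spaces such that $H(\kappa_1)+H(\kappa_2)<\infty$. If $(G,K_1^G,\kappa_1^G)$ is isomorphic to $(G,K_2^G,\kappa_2^G)$, then $H(\kappa_1)=H(\kappa_2)$. -/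

import Mathlib

open MeasureTheory

namespace SoficEntropy

/-! ### Sofic groups -/

/-- For `σ : G → Sym(m)` (not assumed to be a homomorphism) and `F ⊆ G`, the set `V(F)` of all
`v ∈ {1, …, m}` at which `σ` is multiplicative and injective along `F`. -/
def goodSet {G : Type*} [Group G] {m : ℕ} (σ : G → Equiv.Perm (Fin m)) (F : Set G) :
    Set (Fin m) :=
  {v | ∀ f₁ ∈ F, ∀ f₂ ∈ F,
    σ f₁ (σ f₂ v) = σ (f₁ * f₂) v ∧ (f₁ ≠ f₂ → σ f₁ v ≠ σ f₂ v)}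

/-- `σ : G → Sym(m)` is an `(F, ε)`-approximation to `G` if `|V(F)| ≥ (1 - ε) m`. -/
def IsApproximation {G : Type*} [Group G] {m : ℕ} (σ : G → Equiv.Perm (Fin m)) (F : Set G)
    (ε : ℝ) : Prop :=
  (1 - ε) * (m : ℝ) ≤ ((goodSet σ F).ncard : ℝ)

/-- A sequence of maps `σ i : G → Sym(m i)`, with `m i ≥ 1`, is a sofic approximation to `G` if
`σ i` is an `(F i, ε i)`-approximation to `G` for some increasing sequence `F i` of subsets of `G`
with union `G` and some `ε i → 0`. (The sets `F i` are automatically finite: as soon as `ε i < 1`,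
some point has pairwise distinct images under the maps `σ i f` with `f ∈ F i`.) -/
def IsSoficApproximation {G : Type*} [Group G] (m : ℕ → ℕ)
    (σ : (i : ℕ) → G → Equiv.Perm (Fin (m i))) : Prop :=
  (∀ i, 1 ≤ m i) ∧
    ∃ (F : ℕ → Set G) (ε : ℕ → ℝ),
      (∀ i, F i ⊆ F (i + 1)) ∧ (⋃ i, F i) = Set.univ ∧
      Filter.Tendsto ε Filter.atTop (nhds 0) ∧
      ∀ i, IsApproximation (σ i) (F i) (ε i)

/-- A group is sofic if it has a sofic approximation. -/
def IsSofic (G : Type*) [Group G] : Prop :=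
  ∃ (m : ℕ → ℕ) (σ : (i : ℕ) → G → Equiv.Perm (Fin (m i))), IsSoficApproximation m σ

/-! ### Entropy of a probability measure -/

open Classical in
/-- The entropy `H(κ)` of a probability measure: if some countable set has full measure, it is
`-∑ κ({k}) log κ({k})`, otherwise it is `∞`. The sum may be taken over all points `k`, since
points outside a countable set of full measure contribute `0` (see `baseEntropy_eq_tsum`). -/
noncomputable def baseEntropy {K : Type*} [MeasurableSpace K] (κ : Measure K) : ENNReal :=
  if ∃ K' : Set K, K'.Countable ∧ κ K' = 1 then
    ∑' k : K, ENNReal.ofReal (-(κ.real {k} * Real.log (κ.real {k})))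
  else ⊤

/-- The entropy may be computed over any countable set of full measure. -/
theorem baseEntropy_eq_tsum {K : Type*} [MeasurableSpace K] [MeasurableSingletonClass K]
    (κ : Measure K) [IsProbabilityMeasure κ] (K' : Set K) (hc : K'.Countable) (h1 : κ K' = 1) :
    baseEntropy κ = ∑' k : K', ENNReal.ofReal
      (-(κ.real {(k : K)} * Real.log (κ.real {(k : K)}))) := by
  rw [baseEntropy, if_pos ⟨K', hc, h1⟩]
  refine (tsum_subtype_eq_of_support_subset
    (f := fun k : K => ENNReal.ofReal (-(κ.real {k} * Real.log (κ.real {k}))))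
    (fun k hk => ?_)).symm
  by_contra hk'
  apply hk
  have h0 : κ {k} = 0 := by
    have hnull : κ K'ᶜ = 0 := (prob_compl_eq_zero_iff hc.measurableSet).2 h1
    exact measure_mono_null (by simpa using hk') hnull
  simp [Measure.real, h0]

/-! ### Measurable conjugacy of dynamical systems -/

/-- Two systems `(G, X, μ)` and `(G, Y, ν)` are isomorphic (measurably conjugate) if there are
conull sets `X' ⊆ X`, `Y' ⊆ Y` and a bijection `φ : X' → Y'`, measurable with measurable inverse,
with `φ_* μ = ν` and `φ (g x) = g φ(x)` for all `g ∈ G` and `x ∈ X'` (in particular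
`g x ∈ X'`). -/
def Isomorphic (G : Type*) [Group G] {X Y : Type*} [MeasurableSpace X] [MeasurableSpace Y]
    [MulAction G X] [MulAction G Y] (μ : Measure X) (ν : Measure Y) : Prop :=
  ∃ (X' : Set X) (Y' : Set Y) (φ : X' ≃ᵐ Y'),
    μ X'ᶜ = 0 ∧ ν Y'ᶜ = 0 ∧
    MeasurePreserving φ (μ.comap Subtype.val) (ν.comap Subtype.val) ∧
    ∀ (g : G) (x : X) (hx : x ∈ X'),
      ∃ hgx : g • x ∈ X', (φ ⟨g • x, hgx⟩ : Y) = g • (φ ⟨x, hx⟩ : Y)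

/-! ### Bernoulli shifts -/

/-- The space `K^G` of all functions `x : G → K`. -/
def BernoulliSpace (G K : Type*) : Type _ := G → K

/-- The product Borel structure on `K^G`. -/
instance {G K : Type*} [MeasurableSpace K] : MeasurableSpace (BernoulliSpace G K) :=
  inferInstanceAs (MeasurableSpace (G → K))

/-- The shift action `(g x)(f) = x(g⁻¹ f)` of `G` on `K^G`. -/
instance {G K : Type*} [Group G] : MulAction G (BernoulliSpace G K) where
  smul g x := fun f : G => x (g⁻¹ * f)
  one_smul x := by
    funext f
    change x ((1 : G)⁻¹ * f) = x f
    simp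
  mul_smul g h x := by
    funext f
    change x ((g * h)⁻¹ * f) = x (h⁻¹ * (g⁻¹ * f))
    simp [mul_assoc]

/-- The product measure `κ^G` on `K^G`. -/
noncomputable def bernoulliMeasure (G : Type*) {K : Type*} [MeasurableSpace K] (κ : Measure K)
    [IsProbabilityMeasure κ] : Measure (BernoulliSpace G K) :=
  Measure.infinitePi (fun _ : G => κ)

end SoficEntropy

namespace SoficEntropy

open Real

/-! By symmetry only `≤` is needed, and it suffices to bound `shannon κ₁ p` for each finite
colouring `p` of `K₁`. The isomorphism `Φ` makes `p (x 1)` a function of `y = Φ x`, hence, up to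
small probability, a function of the names of `y` on a finite window `W` for a finite colouring `q`
of `K₂`. So `p (x 1)` is nearly decoded from the `W`-translates of the observable `b x = q (Φ x 1)`,
whose entropy is `shannon κ₂ q ≤ H(κ₂)` because `Φ` preserves measure.

It remains to see that such decoding forces `shannon κ₁ p ≤ shannon μ b` up to a small error, where
`μ` is the product measure on `K₁^G` (`exists_shannon_le_of_decoding`). Replace `b` by a nearby
function of finitely many coordinates and transport it to a sofic model: colour `{1, …, m}` by
i.i.d. points of law `κ₁` and evaluate `b` around each `v`. The colours `p (ω v)` have joint entropy
exactly `m * shannon κ₁ p`. They are determined by the values of `b` at all points together with a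
correction at each point, equal to `none` unless decoding fails there. Subadditivity bounds the
joint entropy by the sum over `v`. At a good point the local law is that of `K₁^G`, so the
contribution is at most the entropy of `b` plus the small entropy of the correction; the few bad
points contribute boundedly. Dividing by `m` gives the claim (`shannon_le_of_local_decoding`). -/

/-- Shannon entropy of a finite-valued random variable. -/
noncomputable def shannon {Ω S : Type*} [MeasurableSpace Ω] [Fintype S] (μ : Measure Ω)
    (X : Ω → S) : ℝ :=
  ∑ s, negMulLog (μ.real (X ⁻¹' {s}))

/-! ### Gibbs' inequality and continuity of finite entropy. -/

section FiniteDistributions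

variable {Ω : Type*} [MeasurableSpace Ω] {μ : Measure Ω} {S : Type*}

/-- Absolute continuity of a joint law with respect to the product of its marginals; this is what
Gibbs' inequality needs where the logarithm degenerates. -/
theorem prod_real_eq_zero {V : Type*} [Fintype V] [IsFiniteMeasure μ] (X : Ω → V → S) (s : V → S)
    (h : ∏ v, μ.real ((fun ω => X ω v) ⁻¹' {s v}) = 0) : μ.real (X ⁻¹' {s}) = 0 := by
  obtain ⟨v, -, hv⟩ := Finset.prod_eq_zero_iff.1 h
  refine le_antisymm (le_trans (measureReal_mono fun ω hω => ?_) hv.le) measureReal_nonneg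
  simp only [Set.mem_preimage, Set.mem_singleton_iff] at hω ⊢; rw [hω]

variable [Fintype S]

theorem shannon_nonneg [IsProbabilityMeasure μ] (X : Ω → S) : 0 ≤ shannon μ X :=
  Finset.sum_nonneg fun _ _ => negMulLog_nonneg measureReal_nonneg measureReal_le_one

theorem shannon_le_card [IsProbabilityMeasure μ] (X : Ω → S) :
    shannon μ X ≤ Fintype.card S := by
  refine (Finset.sum_le_card_nsmul _ _ 1 fun s _ => ?_).trans (by simp)
  have h0 : 0 ≤ μ.real (X ⁻¹' {s}) := measureReal_nonneg
  linarith [negMulLog_le_one_sub_self h0]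

/-- Gibbs' inequality. -/
theorem sum_negMulLog_le {ι : Type*} [Fintype ι] {p q : ι → ℝ} (hp : ∀ i, 0 ≤ p i)
    (hq : ∀ i, 0 ≤ q i) (hpq : ∑ i, q i ≤ ∑ i, p i) (h0 : ∀ i, q i = 0 → p i = 0) :
    ∑ i, negMulLog (p i) ≤ ∑ i, p i * -log (q i) := by
  -- This is `log t ≤ t - 1` at `t = q i / p i`, multiplied by `p i`; the added terms `q i - p i`
  -- have nonpositive total.
  have key : ∀ i, negMulLog (p i) ≤ p i * -log (q i) + (q i - p i) := by
    intro i
    rcases (hp i).eq_or_lt with h | h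
    · simp [← h, hq i]
    · have hqi : 0 < q i := (hq i).lt_of_ne fun h' => h.ne' (h0 i h'.symm)
      have hl := log_le_sub_one_of_pos (div_pos hqi h)
      rw [log_div hqi.ne' h.ne'] at hl
      have := mul_le_mul_of_nonneg_left hl h.le
      have e : p i * (q i / p i - 1) = q i - p i := by field_simp
      rw [e] at this
      rw [negMulLog]
      linarith
  calc ∑ i, negMulLog (p i) ≤ ∑ i, (p i * -log (q i) + (q i - p i)) :=
        Finset.sum_le_sum fun i _ => key i
    _ = ∑ i, p i * -log (q i) + (∑ i, q i - ∑ i, p i) := by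
        rw [Finset.sum_add_distrib, Finset.sum_sub_distrib]
    _ ≤ _ := by linarith

/-- Entropy is a continuous function of a distribution on a finite set. -/
theorem exists_forall_sum_negMulLog_lt (r₀ : S → ℝ) {η : ℝ} (hη : 0 < η) :
    ∃ δ > 0, ∀ r : S → ℝ, (∀ s, |r s - r₀ s| < δ) →
      ∑ s, negMulLog (r s) < ∑ s, negMulLog (r₀ s) + η := by
  have hc : Continuous fun r : S → ℝ => ∑ s, negMulLog (r s) := by fun_prop
  obtain ⟨δ, hδ, h⟩ := Metric.continuous_iff.1 hc r₀ η hη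
  refine ⟨δ, hδ, fun r hr => ?_⟩
  have := h r ((dist_pi_lt_iff hδ).2 hr)
  rw [Real.dist_eq] at this
  linarith [(abs_lt.1 this).2]

/-- Each fibre probability changes by at most the probability of disagreement, so continuity in the
distribution applies. -/
theorem exists_shannon_lt (X : Ω → S) [IsProbabilityMeasure μ] {η : ℝ} (hη : 0 < η) :
    ∃ δ > 0, ∀ Y : Ω → S, μ.real {ω | Y ω ≠ X ω} < δ → shannon μ Y < shannon μ X + η := by
  obtain ⟨δ, hδ, h⟩ := exists_forall_sum_negMulLog_lt (fun s => μ.real (X ⁻¹' {s})) hη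
  refine ⟨δ, hδ, fun Y hY => h _ fun s => lt_of_le_of_lt ?_ hY⟩
  have h1 : μ.real (Y ⁻¹' {s}) ≤ μ.real (X ⁻¹' {s}) + μ.real {ω | Y ω ≠ X ω} :=
    (measureReal_mono (fun ω hω => by
      by_cases e : Y ω = X ω
      · left; simpa [← e] using hω
      · right; exact e)).trans (measureReal_union_le _ _)
  have h2 : μ.real (X ⁻¹' {s}) ≤ μ.real (Y ⁻¹' {s}) + μ.real {ω | Y ω ≠ X ω} :=
    (measureReal_mono (fun ω hω => by
      by_cases e : Y ω = X ω
      · left; simpa [e] using hω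
      · right; exact e)).trans (measureReal_union_le _ _)
  rw [abs_le]
  constructor <;> linarith

end FiniteDistributions

/-- A random variable that takes the value `none` with high probability has small entropy. -/
theorem exists_shannon_option_lt (T : Type*) [Fintype T] {η : ℝ} (hη : 0 < η) :
    ∃ δ > 0, ∀ {Ω : Type*} [MeasurableSpace Ω] (μ : Measure Ω) [IsProbabilityMeasure μ]
      (Y : Ω → Option T), MeasurableSet (Y ⁻¹' {none}) → μ.real {ω | Y ω ≠ none} < δ →
      shannon μ Y < η := by
  classical
  -- The reference distribution is the point mass at `none`, of entropy zero.
  obtain ⟨δ, hδ, h⟩ := exists_forall_sum_negMulLog_lt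
    (fun s : Option T => if s = none then (1 : ℝ) else 0) hη
  refine ⟨δ, hδ, fun μ _ Y hm hY => ?_⟩
  have h0 : ∑ s : Option T, negMulLog (if s = none then (1 : ℝ) else 0) = 0 :=
    Finset.sum_eq_zero fun s _ => by split_ifs <;> simp
  refine (h (fun s => μ.real (Y ⁻¹' {s})) ?_).trans_le (by rw [h0, zero_add])
  rintro (_ | t)
  · have := probReal_compl_eq_one_sub (μ := μ) hm
    have e : (Y ⁻¹' {none})ᶜ = {ω | Y ω ≠ none} := by ext; simp
    rw [e] at this
    rw [if_pos rfl, abs_sub_lt_iff]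
    have h1 : μ.real (Y ⁻¹' {none}) ≤ 1 := measureReal_le_one
    constructor <;> linarith
  · have h1 : μ.real (Y ⁻¹' {some t}) ≤ μ.real {ω | Y ω ≠ none} := measureReal_mono fun ω hω => by
      simp only [Set.mem_preimage, Set.mem_singleton_iff] at hω
      simp [hω]
    have h2 : 0 ≤ μ.real (Y ⁻¹' {some t}) := measureReal_nonneg
    simp only [reduceCtorEq, if_false, sub_zero]
    rw [abs_of_nonneg h2]
    linarith

/-! ### Monotonicity and subadditivity of Shannon entropy. -/

section Shannon

variable {Ω : Type*} [MeasurableSpace Ω] {μ : Measure Ω}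
  {S : Type*} [Fintype S] [MeasurableSpace S] [MeasurableSingletonClass S]
  {T : Type*} [Fintype T]

theorem sum_real_preimage_singleton [IsProbabilityMeasure μ] {X : Ω → S} (hX : Measurable X) :
    ∑ s, μ.real (X ⁻¹' {s}) = 1 := by
  rw [sum_measureReal_preimage_singleton _ fun s _ => hX (measurableSet_singleton s)]
  simp

theorem sum_real_comp [IsFiniteMeasure μ] {X : Ω → S} (hX : Measurable X) (f : S → T)
    (g : T → ℝ) :
    ∑ s, μ.real (X ⁻¹' {s}) * g (f s) = ∑ t, μ.real ((fun ω => f (X ω)) ⁻¹' {t}) * g t := by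
  classical
  rw [← Finset.sum_fiberwise Finset.univ f]
  refine Finset.sum_congr rfl fun t _ => ?_
  have h : (fun ω => f (X ω)) ⁻¹' {t} = X ⁻¹' ↑(Finset.univ.filter fun s => f s = t) := by
    ext; simp
  rw [h, ← sum_measureReal_preimage_singleton _ fun s _ => hX (measurableSet_singleton s),
    Finset.sum_mul]
  refine Finset.sum_congr rfl fun s hs => ?_
  rw [(Finset.mem_filter.1 hs).2]

/-- A fibre of `X` lies in a fibre of `f ∘ X`, so passing to `f ∘ X` lowers `-log` of the
probability pointwise; then average over the law of `X`. -/
theorem shannon_comp_le [IsFiniteMeasure μ] {X : Ω → S} (hX : Measurable X) (f : S → T) :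
    shannon μ (fun ω => f (X ω)) ≤ shannon μ X := by
  have h := sum_real_comp (μ := μ) hX f
    (fun t => -log (μ.real ((fun ω => f (X ω)) ⁻¹' {t})))
  have h' : shannon μ (fun ω => f (X ω)) =
      ∑ t, μ.real ((fun ω => f (X ω)) ⁻¹' {t}) *
        -log (μ.real ((fun ω => f (X ω)) ⁻¹' {t})) :=
    Finset.sum_congr rfl fun t _ => by rw [negMulLog]; ring
  rw [h', ← h]
  refine Finset.sum_le_sum fun s _ => ?_
  have hle : μ.real (X ⁻¹' {s}) ≤ μ.real ((fun ω => f (X ω)) ⁻¹' {f s}) :=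
    measureReal_mono fun ω hω => by
      simp only [Set.mem_preimage, Set.mem_singleton_iff] at hω ⊢; rw [hω]
  rcases (measureReal_nonneg (μ := μ) (s := X ⁻¹' {s})).eq_or_lt with h0 | h0
  · simp [← h0]
  · rw [negMulLog, neg_mul, ← mul_neg]
    gcongr

theorem shannon_prodMk_le [MeasurableSpace T] [MeasurableSingletonClass T]
    [IsProbabilityMeasure μ] {X : Ω → S} {Y : Ω → T} (hX : Measurable X)
    (hY : Measurable Y) :
    shannon μ (fun ω => (X ω, Y ω)) ≤ shannon μ X + shannon μ Y := by
  set p : S → ℝ := fun s => μ.real (X ⁻¹' {s})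
  set q : T → ℝ := fun t => μ.real (Y ⁻¹' {t})
  set r : S × T → ℝ := fun z => μ.real ((fun ω => (X ω, Y ω)) ⁻¹' {z})
  have hXY : Measurable fun ω => (X ω, Y ω) := hX.prodMk hY
  have hrp : ∀ z, r z ≤ p z.1 := fun z => measureReal_mono fun ω hω => by
    simp only [Set.mem_preimage, Set.mem_singleton_iff] at hω ⊢; rw [← hω]
  have hrq : ∀ z, r z ≤ q z.2 := fun z => measureReal_mono fun ω hω => by
    simp only [Set.mem_preimage, Set.mem_singleton_iff] at hω ⊢; rw [← hω]
  have hr : ∀ z, 0 ≤ r z := fun z => measureReal_nonneg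
  have hsum : ∑ z : S × T, p z.1 * q z.2 = 1 := by
    rw [Fintype.sum_prod_type, ← Fintype.sum_mul_sum, sum_real_preimage_singleton hX,
      sum_real_preimage_singleton hY, one_mul]
  have hz : ∀ z : S × T, p z.1 * q z.2 = 0 → r z = 0 := by
    intro z hz
    rcases mul_eq_zero.1 hz with h | h
    · exact le_antisymm ((hrp z).trans h.le) (hr z)
    · exact le_antisymm ((hrq z).trans h.le) (hr z)
  have hG := sum_negMulLog_le (p := r) (q := fun z => p z.1 * q z.2) hr
    (fun z => mul_nonneg measureReal_nonneg measureReal_nonneg)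
    (by rw [hsum]; exact (sum_real_preimage_singleton hXY).ge) hz
  refine hG.trans (le_of_eq ?_)
  have hs : ∀ z, r z * -log (p z.1 * q z.2) = r z * -log (p z.1) + r z * -log (q z.2) := by
    intro z
    by_cases h : r z = 0
    · simp [h]
    · have := mt (hz z) h
      rw [log_mul (left_ne_zero_of_mul this) (right_ne_zero_of_mul this)]
      ring
  simp_rw [hs]
  rw [Finset.sum_add_distrib, sum_real_comp hXY Prod.fst fun s => -log (p s),
    sum_real_comp hXY Prod.snd fun s => -log (q s)]
  simp only [shannon, negMulLog, p, q, neg_mul, mul_neg]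

section Pi

variable {V : Type*} [Fintype V] [DecidableEq V]

/-- The cross-entropy of a joint law against the product of its marginals. It yields subadditivity
through Gibbs' inequality, and additivity when the two laws coincide. -/
theorem sum_mul_log_prod [IsFiniteMeasure μ] {X : Ω → V → S} (hX : Measurable X) :
    ∑ s, μ.real (X ⁻¹' {s}) * -log (∏ v, μ.real ((fun ω => X ω v) ⁻¹' {s v})) =
      ∑ v, shannon μ (fun ω => X ω v) := by
  have hs : ∀ s : V → S,
      μ.real (X ⁻¹' {s}) * -log (∏ v, μ.real ((fun ω => X ω v) ⁻¹' {s v})) =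
        ∑ v, μ.real (X ⁻¹' {s}) * -log (μ.real ((fun ω => X ω v) ⁻¹' {s v})) := by
    intro s
    by_cases h : μ.real (X ⁻¹' {s}) = 0
    · simp [h]
    · rw [log_prod fun v _ h0 => h (prod_real_eq_zero X s
        (Finset.prod_eq_zero (Finset.mem_univ v) h0)),
        ← Finset.mul_sum, Finset.sum_neg_distrib]
  simp_rw [hs]
  rw [Finset.sum_comm]
  refine Finset.sum_congr rfl fun v _ => ?_
  rw [sum_real_comp hX (fun s => s v) fun t => -log (μ.real ((fun ω => X ω v) ⁻¹' {t}))]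
  simp only [shannon, negMulLog, neg_mul, mul_neg]

theorem shannon_pi_le [IsProbabilityMeasure μ] {X : Ω → V → S} (hX : Measurable X) :
    shannon μ X ≤ ∑ v, shannon μ (fun ω => X ω v) := by
  rw [← sum_mul_log_prod hX]
  refine sum_negMulLog_le (fun _ => measureReal_nonneg)
    (fun _ => Finset.prod_nonneg fun _ _ => measureReal_nonneg) ?_ (prod_real_eq_zero X)
  rw [sum_real_preimage_singleton hX, ← Fintype.piFinset_univ,
    ← Finset.prod_univ_sum (fun _ : V => (Finset.univ : Finset S))
      fun v t => μ.real ((fun ω => X ω v) ⁻¹' {t})]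
  exact (Finset.prod_eq_one fun v _ =>
    sum_real_preimage_singleton ((measurable_pi_apply v).comp hX)).le

theorem shannon_pi_of_indep [IsFiniteMeasure μ] {X : Ω → V → S} (hX : Measurable X)
    (h : ∀ s, μ.real (X ⁻¹' {s}) = ∏ v, μ.real ((fun ω => X ω v) ⁻¹' {s v})) :
    shannon μ X = ∑ v, shannon μ (fun ω => X ω v) := by
  rw [← sum_mul_log_prod hX]
  refine Finset.sum_congr rfl fun s _ => ?_
  rw [← h, negMulLog]
  ring

end Pi

theorem shannon_comp_of_map_eq {Ω' : Type*} [MeasurableSpace Ω'] {ν : Measure Ω'} {X : Ω → S}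
    {Y : Ω' → S} (hX : Measurable X) (hY : Measurable Y) (h : μ.map X = ν.map Y) :
    shannon μ X = shannon ν Y := by
  refine Finset.sum_congr rfl fun s _ => ?_
  rw [← map_measureReal_apply hX (measurableSet_singleton s), h,
    map_measureReal_apply hY (measurableSet_singleton s)]

end Shannon

/-! ### Product measures: relabelling coordinates and approximation by finite names. -/

section ProductSpaces

variable {I K : Type*}

/-- The points of `I → K` have the same `𝒬`-names on the window `W`. -/
def SameName (W : Finset I) (𝒬 : Finset (Set K)) (y y' : I → K) : Prop :=
  ∀ w ∈ W, ∀ Q ∈ 𝒬, y w ∈ Q ↔ y' w ∈ Q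

theorem SameName.mono {W W' : Finset I} {𝒬 𝒬' : Finset (Set K)} {y y' : I → K}
    (h : SameName W' 𝒬' y y') (hW : W ⊆ W') (h𝒬 : 𝒬 ⊆ 𝒬') : SameName W 𝒬 y y' :=
  fun w hw Q hQ => h w (hW hw) Q (h𝒬 hQ)

variable [MeasurableSpace K]

theorem infinitePi_map_comp_injective {J : Type*} (κ : Measure K) [IsProbabilityMeasure κ]
    {ι : J → I} (hι : Function.Injective ι) :
    (Measure.infinitePi fun _ : I => κ).map (fun x j => x (ι j)) =
      Measure.infinitePi fun _ : J => κ := by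
  classical
  refine Measure.eq_infinitePi _ fun s t ht => ?_
  rw [Measure.map_apply (by fun_prop) (.pi s.countable_toSet fun i _ => ht i)]
  let t' : I → Set K := Function.extend ι t fun _ => Set.univ
  have ht' : ∀ i, MeasurableSet (t' i) := by
    intro i
    by_cases h : ∃ j, ι j = i
    · obtain ⟨j, rfl⟩ := h
      simpa [t', hι.extend_apply] using ht j
    · simp [t', Function.extend_apply' _ _ _ h]
  have e : (fun (x : I → K) j => x (ι j)) ⁻¹' (s : Set J).pi t =
      (s.image ι : Set I).pi t' := by
    ext x
    simp [Set.mem_pi, t', hι.extend_apply]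
  rw [e, Measure.infinitePi_pi _ fun i _ => ht' i,
    Finset.prod_image hι.injOn]
  simp [t', hι.extend_apply]

/-- A function of finitely many coordinates has the same law under any injective relabelling of
these coordinates. -/
theorem map_comp_eq_of_dependsOn {G S : Type*} [MeasurableSpace S] (κ : Measure K)
    [IsProbabilityMeasure κ] {E : Finset G} {D : (G → K) → S} (hD : Measurable D)
    (hE : DependsOn D (E : Set G)) {J : G → I} (hJ : Set.InjOn J E) :
    (Measure.infinitePi fun _ : I => κ).map (fun ω => D fun g => ω (J g)) =
      (Measure.infinitePi fun _ : G => κ).map D := by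
  classical
  have : Nonempty K := nonempty_of_isProbabilityMeasure κ
  -- Filling in an arbitrary value off `E` factors `D` through restriction to `E`, where the
  -- relabelling is injective.
  let ext : (E → K) → G → K := fun z g => if h : g ∈ E then z ⟨g, h⟩ else Classical.arbitrary K
  have hext : Measurable ext := by
    refine measurable_pi_lambda _ fun g => ?_
    by_cases h : g ∈ E <;> simp only [ext, h, dite_true, dite_false] <;> fun_prop
  have h1 : (fun ω : I → K => D fun g => ω (J g)) =
      (fun z => D (ext z)) ∘ fun ω (e : E) => ω (J e) := by
    funext ω
    exact hE fun g hg => by simp [ext, Finset.mem_coe.1 hg]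
  have h2 : D = (fun z => D (ext z)) ∘ fun x (e : E) => x (e : G) := by
    funext ω
    exact hE fun g hg => by simp [ext, Finset.mem_coe.1 hg]
  rw [h1]
  conv_rhs => rw [h2]
  rw [← Measure.map_map (by fun_prop) (by fun_prop), ← Measure.map_map (by fun_prop) (by fun_prop),
    infinitePi_map_comp_injective κ (ι := fun e : E => J e) fun a b h =>
      Subtype.ext (hJ a.2 b.2 h),
    infinitePi_map_comp_injective κ (ι := fun e : E => (e : G)) Subtype.val_injective]

variable (I K) in
/-- The measurable sets that are determined by a finite name. -/
def finiteNameSets : Set (Set (I → K)) :=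
  {C | MeasurableSet C ∧ ∃ (W : Finset I) (𝒬 : Finset (Set K)), (∀ Q ∈ 𝒬, MeasurableSet Q) ∧
    ∀ y y', SameName W 𝒬 y y' → (y ∈ C ↔ y' ∈ C)}

theorem isSetAlgebra_finiteNameSets : IsSetAlgebra (finiteNameSets I K) where
  empty_mem := ⟨.empty, ∅, ∅, by simp, by simp⟩
  compl_mem := by
    rintro C ⟨hC, W, 𝒬, h𝒬, h⟩
    exact ⟨hC.compl, W, 𝒬, h𝒬, fun y y' hy => not_congr (h y y' hy)⟩
  union_mem := by
    classical
    rintro C C' ⟨hC, W, 𝒬, h𝒬, h⟩ ⟨hC', W', 𝒬', h𝒬', h'⟩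
    refine ⟨hC.union hC', W ∪ W', 𝒬 ∪ 𝒬', fun Q hQ => ?_, fun y y' hy => ?_⟩
    · exact (Finset.mem_union.1 hQ).elim (h𝒬 Q) (h𝒬' Q)
    · exact or_congr (h y y' (hy.mono Finset.subset_union_left Finset.subset_union_left))
        (h' y y' (hy.mono Finset.subset_union_right Finset.subset_union_right))

theorem generateFrom_finiteNameSets :
    (MeasurableSpace.pi : MeasurableSpace (I → K)) =
      MeasurableSpace.generateFrom (finiteNameSets I K) := by
  refine le_antisymm ?_ (MeasurableSpace.generateFrom_le fun C hC => hC.1)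
  refine iSup_le fun i => ?_
  rintro _ ⟨Q, hQ, rfl⟩
  refine MeasurableSpace.measurableSet_generateFrom
    ⟨measurable_pi_apply i hQ, {i}, {Q}, by simpa using hQ, fun y y' hy => ?_⟩
  exact hy i (by simp) Q (by simp)

/-- Finite-valued measurable functions on a product space are approximated by functions of a
finite name. -/
theorem exists_finite_name_approx {T : Type*} [Fintype T] [MeasurableSpace T]
    [MeasurableSingletonClass T] (μ : Measure (I → K)) [IsProbabilityMeasure μ]
    {f : (I → K) → T} (hf : Measurable f) {δ : ℝ} (hδ : 0 < δ) :
    ∃ (W : Finset I) (𝒬 : Finset (Set K)) (f' : (I → K) → T), (∀ Q ∈ 𝒬, MeasurableSet Q) ∧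
      Measurable f' ∧ (∀ y y', SameName W 𝒬 y y' → f' y = f' y') ∧
      μ.real {y | f' y ≠ f y} < δ := by
  classical
  obtain ⟨y₀⟩ : Nonempty (I → K) := nonempty_of_isProbabilityMeasure μ
  have : Nonempty T := ⟨f y₀⟩
  have hdense := Measure.MeasureDense.of_generateFrom_isSetAlgebra_finite (μ := μ)
    isSetAlgebra_finiteNameSets generateFrom_finiteNameSets
  have hT : (0 : ℝ) < Fintype.card T := by exact_mod_cast Fintype.card_pos
  choose C hC hμC using fun t => hdense.approx (f ⁻¹' {t}) (hf (measurableSet_singleton t))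
    (measure_ne_top _ _) (δ / Fintype.card T) (by positivity)
  choose hCm W 𝒬 h𝒬 hname using hC
  -- Reads a value off the pattern of memberships in the sets `C t`. Outside the symmetric
  -- differences the pattern singles out `f y`; elsewhere the choice is immaterial.
  let dec : (T → Prop) → T := fun b => if h : ∃ t, b t then h.choose else Classical.arbitrary T
  have hdec : ∀ t, dec (fun s => s = t) = t := by
    intro t
    have h : ∃ s, s = t := ⟨t, rfl⟩
    simp only [dec]
    rw [dif_pos h]
    exact h.choose_spec
  refine ⟨Finset.univ.biUnion W, Finset.univ.biUnion 𝒬, fun y => dec fun t => y ∈ C t,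
    fun Q hQ => ?_, ?_, fun y y' hy => ?_, ?_⟩
  · obtain ⟨t, -, ht⟩ := Finset.mem_biUnion.1 hQ
    exact h𝒬 t Q ht
  · exact (measurable_of_finite dec).comp
      (measurable_pi_lambda _ fun t => measurable_mem.2 (hCm t))
  · have h : ∀ t, y ∈ C t ↔ y' ∈ C t := fun t => hname t y y'
      (hy.mono (Finset.subset_biUnion_of_mem W (Finset.mem_univ t))
        (Finset.subset_biUnion_of_mem 𝒬 (Finset.mem_univ t)))
    simp only [h]
  · have hsub : {y | (dec fun t => y ∈ C t) ≠ f y} ⊆ ⋃ t, symmDiff (f ⁻¹' {t}) (C t) := by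
      intro y hy
      by_contra hn
      apply hy
      have : (fun t => y ∈ C t) = fun t => t = f y := by
        funext t
        simp only [Set.mem_iUnion, not_exists, Set.mem_symmDiff, Set.mem_preimage,
          Set.mem_singleton_iff] at hn
        have := hn t
        apply propext
        constructor <;> intro <;> grind
      rw [this, hdec]
    calc μ.real {y | (dec fun t => y ∈ C t) ≠ f y}
        ≤ μ.real (⋃ t, symmDiff (f ⁻¹' {t}) (C t)) := measureReal_mono hsub
      _ ≤ ∑ t, μ.real (symmDiff (f ⁻¹' {t}) (C t)) := measureReal_iUnion_fintype_le _
      _ < ∑ _t : T, δ / Fintype.card T := by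
        refine Finset.sum_lt_sum_of_nonempty Finset.univ_nonempty fun t _ => ?_
        rw [Measure.real, ← ENNReal.toReal_ofReal (r := δ / Fintype.card T) (by positivity)]
        exact (ENNReal.toReal_lt_toReal (measure_ne_top _ _) ENNReal.ofReal_ne_top).2 (hμC t)
      _ = δ := by simp; field_simp

end ProductSpaces

/-! ### Extracting one sofic model, and the entropy of i.i.d. colourings. -/

theorem goodSet_antitone {G : Type*} [Group G] {m : ℕ} (σ : G → Equiv.Perm (Fin m)) {F F' : Set G}
    (h : F ⊆ F') : goodSet σ F' ⊆ goodSet σ F :=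
  fun _ hv f₁ h₁ f₂ h₂ => hv f₁ (h h₁) f₂ (h h₂)

theorem IsSofic.exists_isApproximation {G : Type*} [Group G] (hG : IsSofic G) (E : Finset G)
    {ε : ℝ} (hε : 0 < ε) :
    ∃ (m : ℕ) (σ : G → Equiv.Perm (Fin m)), 1 ≤ m ∧ IsApproximation σ (E : Set G) ε := by
  obtain ⟨m, σ, hm, F, e, hF, hU, he, happ⟩ := hG
  have hmono : Monotone F := monotone_nat_of_le_succ hF
  have hE : ∀ᶠ i in Filter.atTop, (E : Set G) ⊆ F i := by
    have : ∀ g ∈ E, ∀ᶠ i in Filter.atTop, g ∈ F i := by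
      intro g _
      obtain ⟨i, hi⟩ := Set.mem_iUnion.1 (hU ▸ Set.mem_univ g)
      exact Filter.eventually_atTop.2 ⟨i, fun j hj => hmono hj hi⟩
    filter_upwards [(Filter.eventually_all_finset E).2 this] with i hi g hg using hi g hg
  obtain ⟨i, hi, hi'⟩ := (hE.and (he.eventually (gt_mem_nhds hε))).exists
  refine ⟨m i, σ i, hm i, ?_⟩
  have h1 : ((goodSet (σ i) (F i)).ncard : ℝ) ≤ (goodSet (σ i) (E : Set G)).ncard := by
    exact_mod_cast Set.ncard_le_ncard (goodSet_antitone _ hi) (Set.toFinite _)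
  have h2 := happ i
  simp only [IsApproximation] at h2 ⊢
  refine le_trans ?_ (h2.trans h1)
  gcongr

theorem shannon_iid {V K T : Type*} [Fintype V] [DecidableEq V] [MeasurableSpace K] (κ : Measure K)
    [IsProbabilityMeasure κ] [Fintype T] [MeasurableSpace T] [MeasurableSingletonClass T]
    {p : K → T} (hp : Measurable p) :
    shannon (Measure.infinitePi fun _ : V => κ) (fun ω v => p (ω v)) =
      Fintype.card V * shannon κ p := by
  have hv : ∀ (v : V) (t : T), (Measure.infinitePi fun _ : V => κ).real
      ((fun ω => p (ω v)) ⁻¹' {t}) = κ.real (p ⁻¹' {t}) := by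
    intro v t
    exact (measurePreserving_eval_infinitePi (fun _ : V => κ) v).measureReal_preimage
      (hp (measurableSet_singleton t)).nullMeasurableSet
  rw [shannon_pi_of_indep (by fun_prop)]
  · simp [shannon, hv]
  · intro s
    simp only [hv]
    have e : (fun (ω : V → K) v => p (ω v)) ⁻¹' {s} =
        ((Finset.univ : Finset V) : Set V).pi fun v => p ⁻¹' {s v} := by
      ext ω; simp [funext_iff, Set.mem_pi]
    rw [e, Measure.real, Measure.infinitePi_pi _ fun v _ => hp (measurableSet_singleton _),
      ENNReal.toReal_prod]
    rfl

theorem preimage_singleton_true {α : Type*} (R : α → Prop) : R ⁻¹' {True} = {x | R x} := by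
  ext x; simp

/-! ### Local observables on sofic models and the decoding inequality. -/

section Models

variable {G : Type*} [Group G] {K : Type*} {m : ℕ}

/-- The pullback to `G` of a colouring of `{1, …, m}` along the orbit map at `v`. -/
def pullback (σ : G → Equiv.Perm (Fin m)) (v : Fin m) (ω : Fin m → K) : G → K :=
  fun g => ω (σ g⁻¹ v)

theorem injOn_of_mem_goodSet {σ : G → Equiv.Perm (Fin m)} {E : Finset G} {v : Fin m}
    (hv : v ∈ goodSet σ {g | g⁻¹ ∈ E}) : Set.InjOn (fun g => σ g⁻¹ v) E := by
  intro g hg h hh hgh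
  by_contra hne
  exact (hv g⁻¹ (by simpa using hg) h⁻¹ (by simpa using hh)).2 (by simpa using hne) hgh

variable [MeasurableSpace K]

/-- Around a good point the orbit map is injective on `E`, so the colours seen there are i.i.d.,
exactly as in `K^G`. -/
theorem map_pullback_eq {S : Type*} [MeasurableSpace S] (κ : Measure K) [IsProbabilityMeasure κ]
    {σ : G → Equiv.Perm (Fin m)} {E : Finset G} {v : Fin m}
    (hv : v ∈ goodSet σ {g | g⁻¹ ∈ E}) {D : (G → K) → S} (hD : Measurable D)
    (hE : DependsOn D (E : Set G)) :
    (Measure.infinitePi fun _ : Fin m => κ).map (fun ω => D (pullback σ v ω)) =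
      (Measure.infinitePi fun _ : G => κ).map D :=
  map_comp_eq_of_dependsOn κ hD hE (injOn_of_mem_goodSet hv)

theorem measurable_pullback (σ : G → Equiv.Perm (Fin m)) (v : Fin m) :
    Measurable (pullback (K := K) σ v) := by
  unfold pullback; fun_prop

/-- The entropy of the colouring `p` of the base is at most that of any local observable from
which it can be decoded with small error. -/
theorem shannon_le_of_local_decoding (hG : IsSofic G) (κ : Measure K) [IsProbabilityMeasure κ]
    {S T : Type*} [Fintype S] [MeasurableSpace S] [MeasurableSingletonClass S]
    [Fintype T] [MeasurableSpace T] [MeasurableSingletonClass T] {p : K → T} (hp : Measurable p)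
    {b : (G → K) → S} (hb : Measurable b) {F : Finset G} (hbF : DependsOn b (F : Set G))
    (W : Finset G) (A : (W → S) → T) {η δ : ℝ} (hη : 0 < η)
    (hδ : ∀ (m : ℕ) (μ : Measure (Fin m → K)) [IsProbabilityMeasure μ] (Y : (Fin m → K) → Option T),
      MeasurableSet (Y ⁻¹' {none}) → μ.real {ω | Y ω ≠ none} < δ → shannon μ Y < η)
    (hA : (Measure.infinitePi fun _ : G => κ).real
      {x | A (fun w => b fun f => x (w * f)) ≠ p (x 1)} < δ) :
    shannon κ p ≤ shannon (Measure.infinitePi fun _ : G => κ) b + 2 * η := by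
  classical
  let _ : MeasurableSpace (Option T) := ⊤
  set H := shannon (Measure.infinitePi fun _ : G => κ) b
  have hH : 0 ≤ H := shannon_nonneg b
  -- The window seen from `v` must contain `v` itself and all coordinates read by the `W`-translates
  -- of `b`.
  let E : Finset G := insert 1 (F ∪ W ∪ Finset.image₂ (· * ·) W F)
  have h1E : (1 : G) ∈ E := by simp [E]
  have hFE : F ⊆ E := fun f hf => by simp [E, hf]
  have hWE : W ⊆ E := fun f hf => by simp [E, hf]
  have hWFE : ∀ w ∈ W, ∀ f ∈ F, w * f ∈ E := fun w hw f hf =>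
    Finset.mem_insert_of_mem (Finset.mem_union_right _ (Finset.mem_image₂_of_mem hw hf))
  -- A crude bound for the entropy contributed by a bad point; the fraction of bad points is then
  -- taken to be at most `η / M`.
  set M : ℝ := Fintype.card S + Fintype.card (Option T)
  have hM : 0 < M := by
    have : 0 < Fintype.card (Option T) := Fintype.card_pos
    positivity
  obtain ⟨m, σ, hm, happ⟩ := hG.exists_isApproximation (E.image fun g => g⁻¹) (div_pos hη hM)
  have hEinv : ((E.image fun g => g⁻¹ : Finset G) : Set G) = {g | g⁻¹ ∈ E} := by
    ext g
    simp only [Finset.coe_image, Set.mem_image, Finset.mem_coe, Set.mem_ofPred_eq]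
    exact ⟨by rintro ⟨x, hx, rfl⟩; simpa using hx, fun h => ⟨g⁻¹, h, inv_inv g⟩⟩
  rw [hEinv] at happ
  set V := goodSet σ {g | g⁻¹ ∈ E}
  set P := Measure.infinitePi fun _ : Fin m => κ
  let B : Fin m → (Fin m → K) → S := fun v ω => b (pullback σ v ω)
  -- The correction: it stores the true colour exactly when decoding fails, so `B` and `e` together
  -- determine all colours.
  let e : Fin m → (Fin m → K) → Option T := fun v ω =>
    if A (fun w => B (σ (w : G)⁻¹ v) ω) = p (ω v) then none else some (p (ω v))
  have hB : ∀ v, Measurable (B v) := fun v => hb.comp (measurable_pullback σ v)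
  have he : ∀ v, Measurable (e v) := fun v => by
    have : e v = (fun z : (W → S) × T => if A z.1 = z.2 then none else some z.2) ∘
      fun ω => (fun w => B (σ (w : G)⁻¹ v) ω, p (ω v)) := rfl
    rw [this]
    exact (measurable_of_finite _).comp (by fun_prop)
  let Z : (Fin m → K) → Fin m → S × Option T := fun ω v => (B v ω, e v ω)
  have hZ : Measurable Z := measurable_pi_lambda _ fun v => (hB v).prodMk (he v)
  let decode : (Fin m → S × Option T) → Fin m → T := fun z v =>
    (z v).2.getD (A fun w => (z (σ (w : G)⁻¹ v)).1)
  have hrec : (fun (ω : Fin m → K) v => p (ω v)) = fun ω => decode (Z ω) := by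
    funext ω v
    by_cases h : A (fun w => B (σ (w : G)⁻¹ v) ω) = p (ω v)
    · simp [decode, Z, e, h]
    · simp [decode, Z, e, h]
  have htotal : m * shannon κ p ≤ ∑ v, (shannon P (B v) + shannon P (e v)) := by
    have h1 := shannon_iid (V := Fin m) κ hp
    rw [Fintype.card_fin] at h1
    rw [← h1, hrec]
    have h2 : shannon P (fun ω => decode (Z ω)) ≤ shannon P Z := shannon_comp_le hZ decode
    have h3 : shannon P Z ≤ ∑ v, shannon P (fun ω => Z ω v) := shannon_pi_le hZ
    refine h2.trans (h3.trans ?_)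
    exact Finset.sum_le_sum fun v _ => shannon_prodMk_le (hB v) (he v)
  have hgood : ∀ v ∈ V, shannon P (B v) + shannon P (e v) ≤ H + η := by
    intro v hv
    have h1 : shannon P (B v) = H := shannon_comp_of_map_eq (hB v) hb
      (map_pullback_eq κ hv hb (hbF.mono (by exact_mod_cast hFE)))
    let D : (G → K) → Prop := fun x => A (fun w => b fun f => x (w * f)) ≠ p (x 1)
    have hD : Measurable D := by
      have : D = (fun z : (W → S) × T => A z.1 ≠ z.2) ∘
        fun x => (fun w => b fun f => x (w * f), p (x 1)) := rfl
      rw [this]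
      exact (measurable_of_finite _).comp (by fun_prop)
    have hDE : DependsOn D (E : Set G) := by
      intro x y hxy
      have h1 : ∀ w : W, (b fun f => x (w * f)) = b fun f => y (w * f) := fun w =>
        hbF fun f hf => hxy _ (hWFE w w.2 f hf)
      simp only [D, h1, hxy 1 h1E]
    have hset : ∀ ω, e v ω ≠ none ↔ D (pullback σ v ω) := by
      intro ω
      -- Goodness gives `σ 1 (σ 1 v) = σ 1 v`; cancel the permutation.
      have hone : σ (1 : G)⁻¹ v = v := by
        have := (hv 1 (by simpa using h1E) 1 (by simpa using h1E)).1
        rw [inv_one]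
        exact (σ 1).injective (by simpa using this)
      -- Multiplicativity at `v` identifies the pullback at `σ w⁻¹ v` with the `w`-translate of the
      -- pullback at `v`, on the coordinates in `F`.
      have hw : ∀ w : W, B (σ (w : G)⁻¹ v) ω = b fun f => pullback σ v ω (w * f) := by
        intro w
        refine hbF fun f hf => ?_
        simp only [pullback]
        rw [(hv f⁻¹ (by simpa using hFE hf) (w : G)⁻¹ (by simpa using hWE w.2)).1, mul_inv_rev]
      have hp1 : p (pullback σ v ω 1) = p (ω v) := by rw [pullback, hone]
      simp only [D, hp1, ← hw, e]
      split_ifs with h <;> simp [h]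
    have h2 : P.real {ω | e v ω ≠ none} < δ := by
      have hmap := map_pullback_eq κ hv hD hDE
      have h3 : P {ω | D (pullback σ v ω)} = (Measure.infinitePi fun _ : G => κ) {x | D x} := by
        have hDv : Measurable fun ω => D (pullback σ v ω) := hD.comp (measurable_pullback σ v)
        have := congrArg (fun ν => ν {True}) hmap
        rwa [Measure.map_apply hDv (measurableSet_singleton _),
          Measure.map_apply hD (measurableSet_singleton _), preimage_singleton_true,
          preimage_singleton_true] at this
      simp_rw [hset]
      rw [Measure.real, h3]
      exact hA
    have h3 := hδ m P (e v) (he v (measurableSet_singleton none)) h2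
    linarith
  have hall : ∀ v, shannon P (B v) + shannon P (e v) ≤ H + η + if v ∈ V then 0 else M := by
    intro v
    split_ifs with hv
    · simpa using hgood v hv
    · have h1 : shannon P (B v) ≤ Fintype.card S := shannon_le_card _
      have h2 : shannon P (e v) ≤ Fintype.card (Option T) := shannon_le_card _
      simp only [M]
      linarith
  have hbad : ∑ v, (if v ∈ V then 0 else M) ≤ m * η := by
    have hc : ((Finset.univ.filter fun v => v ∈ V).card : ℝ) = V.ncard := by
      rw [Set.ncard_eq_toFinset_card', ← Set.filter_mem_univ_eq_toFinset]
    have hs := Finset.card_filter_add_card_filter_not (s := (Finset.univ : Finset (Fin m)))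
      fun v => v ∈ V
    rw [Finset.card_fin] at hs
    have hs' : (V.ncard : ℝ) + (Finset.univ.filter fun v => v ∉ V).card = m := by
      rw [← hc]; exact_mod_cast hs
    have hb : ((Finset.univ.filter fun v => v ∉ V).card : ℝ) ≤ η / M * m := by
      have := happ
      simp only [IsApproximation] at this
      linarith
    rw [Finset.sum_ite, Finset.sum_const_zero, zero_add, Finset.sum_const, nsmul_eq_mul]
    calc _ ≤ η / M * m * M := by gcongr
      _ = m * η := by field_simp
  have hfinal : m * shannon κ p ≤ m * (H + 2 * η) := by
    refine htotal.trans ((Finset.sum_le_sum fun v _ => hall v).trans ?_)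
    rw [Finset.sum_add_distrib]
    simp only [Finset.sum_const, nsmul_eq_mul, Finset.card_univ, Fintype.card_fin]
    linarith
  exact le_of_mul_le_mul_left hfinal (by exact_mod_cast hm)

/-- The entropy of the colouring `p` of the base is at most that of any finite observable from
whose translates it can be decoded with small error. -/
theorem exists_shannon_le_of_decoding (hG : IsSofic G) (κ : Measure K) [IsProbabilityMeasure κ]
    {T : Type*} [Fintype T] [MeasurableSpace T] [MeasurableSingletonClass T] {p : K → T}
    (hp : Measurable p) {η : ℝ} (hη : 0 < η) :
    ∃ δ > 0, ∀ {S : Type*} [Fintype S] [MeasurableSpace S] [MeasurableSingletonClass S]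
      {b : (G → K) → S} (_ : Measurable b) (W : Finset G) (A : (W → S) → T),
      (Measure.infinitePi fun _ : G => κ).real
        {x | A (fun w => b fun f => x (w * f)) ≠ p (x 1)} < δ →
      shannon κ p ≤ shannon (Measure.infinitePi fun _ : G => κ) b + 3 * η := by
  classical
  -- The tolerance depends only on `T` and `η`. This matters because `b` and `W` will be constructed
  -- from `δ`.
  obtain ⟨δ, hδ, hfano⟩ := exists_shannon_option_lt T hη
  refine ⟨δ, hδ, fun {S} _ _ _ {b} hb W A hA => ?_⟩
  set μ := Measure.infinitePi fun _ : G => κ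
  obtain ⟨δ₁, hδ₁, hcont⟩ := exists_shannon_lt (μ := μ) b hη
  -- The slack in the decoding error, to be shared among the `W.card` translates; the `+ 1` below
  -- covers empty `W` and keeps the final inequality strict.
  set γ := δ - μ.real {x | A (fun w => b fun f => x (w * f)) ≠ p (x 1)}
  have hγ0 : 0 < γ := sub_pos.2 hA
  obtain ⟨F, 𝒬, b', -, hb', hname, hclose⟩ := exists_finite_name_approx μ hb
    (lt_min hδ₁ (div_pos hγ0 (by positivity : (0 : ℝ) < W.card + 1)))
  have hb'F : DependsOn b' (F : Set G) := fun x y hxy =>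
    hname x y fun w hw Q _ => by rw [hxy w hw]
  have hshift : ∀ w : G, μ.real {x | b' (fun f => x (w * f)) ≠ b fun f => x (w * f)} =
      μ.real {x | b' x ≠ b x} := by
    intro w
    have hmp : MeasurePreserving (fun (x : G → K) f => x (w * f)) μ μ :=
      ⟨by fun_prop, infinitePi_map_comp_injective κ (mul_right_injective w)⟩
    have hm : MeasurableSet {x | b' x ≠ b x} := by
      have : {x | b' x ≠ b x} = (fun x => (b' x, b x)) ⁻¹' {z | z.1 ≠ z.2} := rfl
      rw [this]
      exact (hb'.prodMk hb) (Set.toFinite _).measurableSet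
    exact hmp.measureReal_preimage hm.nullMeasurableSet
  have hsub : {x : G → K | A (fun w => b' fun f => x (w * f)) ≠ p (x 1)} ⊆
      {x | A (fun w => b fun f => x (w * f)) ≠ p (x 1)} ∪
        ⋃ w : W, {x | b' (fun f => x (w * f)) ≠ b fun f => x (w * f)} := by
    intro x hx
    by_contra hn
    simp only [Set.mem_union, Set.mem_iUnion, Set.mem_ofPred_eq, not_or, not_exists, not_not] at hn
    refine hx ?_
    simp only [hn.2]
    exact hn.1
  have hA' : μ.real {x | A (fun w => b' fun f => x (w * f)) ≠ p (x 1)} < δ := by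
    have h1 : μ.real (⋃ w : W, {x | b' (fun f => x (w * f)) ≠ b fun f => x (w * f)}) ≤
        W.card * (γ / (W.card + 1)) := by
      refine (measureReal_iUnion_fintype_le _).trans ?_
      simp only [hshift, Finset.sum_const, Finset.card_univ, Fintype.card_coe, nsmul_eq_mul]
      gcongr
      exact hclose.le.trans (min_le_right _ _)
    have h2 : W.card * (γ / (W.card + 1)) < γ := by
      rw [mul_div_assoc', div_lt_iff₀ (by positivity)]
      nlinarith
    have h3 := (measureReal_mono (μ := μ) hsub).trans (measureReal_union_le _ _)
    linarith
  have h4 := shannon_le_of_local_decoding hG κ hp hb' hb'F W A hη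
    (fun m ν _ Y => hfano ν Y) hA'
  have h5 := hcont b' (hclose.trans_le (min_le_left _ _))
  linarith

end Models

/-! ### Base entropy versus entropies of finite colourings. -/

section BaseEntropy

variable {K : Type*} [MeasurableSpace K] [MeasurableSingletonClass K]

theorem measure_eq_tsum_indicator (κ : Measure K) [IsProbabilityMeasure κ] {K' : Set K}
    (hc : K'.Countable) (h1 : κ K' = 1) (A : Set K) :
    κ A = ∑' k : (A ∩ K' : Set K), κ {(k : K)} := by
  have hnull : κ K'ᶜ = 0 := (prob_compl_eq_zero_iff hc.measurableSet).2 h1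
  have hAK : κ (A ∩ K') = κ A := by
    refine measure_inter_conull hnull
  have hc' : (A ∩ K').Countable := hc.mono Set.inter_subset_right
  have := measure_biUnion (μ := κ) hc' (f := fun k => {k})
    (fun a _ b _ hab => Set.disjoint_singleton.2 hab) fun k _ => measurableSet_singleton k
  rw [Set.biUnion_of_singleton] at this
  rw [← hAK, this]

/-- Split `κ A` into its atoms and use `-log (κ A) ≤ -log (κ {k})` for each atom `k` in `A`. -/
theorem ofReal_negMulLog_le_tsum (κ : Measure K) [IsProbabilityMeasure κ] {K' : Set K}
    (hc : K'.Countable) (h1 : κ K' = 1) (A : Set K) :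
    ENNReal.ofReal (negMulLog (κ.real A)) ≤
      ∑' k, A.indicator (fun k => ENNReal.ofReal (-(κ.real {k} * log (κ.real {k})))) k := by
  have e : ∀ B : Set K, ENNReal.ofReal (negMulLog (κ.real B)) =
      κ B * ENNReal.ofReal (-log (κ.real B)) := by
    intro B
    rw [negMulLog, neg_mul, ← mul_neg, ENNReal.ofReal_mul measureReal_nonneg,
      ofReal_measureReal]
  have e' : ∀ k, ENNReal.ofReal (-(κ.real {k} * log (κ.real {k}))) =
      κ {k} * ENNReal.ofReal (-log (κ.real {k})) := by
    intro k
    rw [← e, negMulLog, neg_mul]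
  rw [← tsum_subtype, e]
  simp_rw [e']
  nth_rw 1 [measure_eq_tsum_indicator κ hc h1 A]
  rw [← ENNReal.tsum_mul_right]
  refine le_trans (ENNReal.tsum_le_tsum fun k => ?_)
    (ENNReal.tsum_mono_subtype (fun k => κ {k} * ENNReal.ofReal (-log (κ.real {k})))
      (Set.inter_subset_left : A ∩ K' ⊆ A))
  by_cases h0 : κ {(k : K)} = 0
  · simp [h0]
  · have hpos : 0 < κ.real {(k : K)} := ENNReal.toReal_pos h0 (measure_ne_top _ _)
    have hle : κ.real {(k : K)} ≤ κ.real A := measureReal_mono (Set.singleton_subset_iff.2 k.2.1)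
    gcongr

/-- Coarsening to a finite alphabet does not increase entropy. -/
theorem ofReal_shannon_le_baseEntropy (κ : Measure K) [IsProbabilityMeasure κ] {S : Type*}
    [Fintype S] (q : K → S) :
    ENNReal.ofReal (shannon κ q) ≤ baseEntropy κ := by
  classical
  rw [baseEntropy]
  split_ifs with h
  · obtain ⟨K', hc, h1⟩ := h
    rw [shannon, ENNReal.ofReal_sum_of_nonneg fun s _ =>
      negMulLog_nonneg measureReal_nonneg measureReal_le_one]
    refine (Finset.sum_le_sum fun s _ =>
      ofReal_negMulLog_le_tsum κ hc h1 (q ⁻¹' {s})).trans ?_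
    rw [← Summable.tsum_finsetSum fun _ _ => ENNReal.summable]
    refine ENNReal.tsum_le_tsum fun k => le_of_eq ?_
    simp [Set.indicator_apply]
  · exact le_top

/-- Entropy is approximated from below by finite coarsenings. -/
theorem baseEntropy_le_of_forall_shannon_le {K : Type u} [MeasurableSpace K]
    [MeasurableSingletonClass K] (κ : Measure K) [IsProbabilityMeasure κ]
    (hfin : baseEntropy κ < ⊤) {c : ENNReal}
    (h : ∀ (T : Type u) [Fintype T] [MeasurableSpace T] [MeasurableSingletonClass T] (p : K → T),
      Measurable p → ENNReal.ofReal (shannon κ p) ≤ c) : baseEntropy κ ≤ c := by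
  classical
  rw [baseEntropy] at hfin ⊢
  split_ifs at hfin ⊢ with hK
  · rw [ENNReal.tsum_eq_iSup_sum]
    refine iSup_le fun s => ?_
    -- Separates the points of `s` from each other and from everything else; all points outside `s`
    -- share one code.
    let p : K → s → Prop := fun k j => k = j
    have hp : Measurable p := measurable_pi_lambda _ fun j =>
      measurable_mem.2 (measurableSet_singleton (j : K))
    have hinj : Set.InjOn p s := fun a ha b hb hab => by
      have := congrFun hab ⟨b, hb⟩
      simpa [p] using this
    have hfib : ∀ k ∈ s, p ⁻¹' {p k} = {k} := by
      intro k hk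
      ext a
      simp only [Set.mem_preimage, Set.mem_singleton_iff]
      refine ⟨fun ha => ?_, fun ha => by rw [ha]⟩
      have := congrFun ha ⟨k, hk⟩
      simpa [p] using this
    refine le_trans ?_ (h (s → Prop) p hp)
    rw [shannon, ENNReal.ofReal_sum_of_nonneg fun s _ =>
      negMulLog_nonneg measureReal_nonneg measureReal_le_one]
    calc _ = ∑ k ∈ s, ENNReal.ofReal (negMulLog (κ.real (p ⁻¹' {p k}))) :=
          Finset.sum_congr rfl fun k hk => by rw [hfib k hk, negMulLog, neg_mul]
      _ = ∑ t ∈ s.image p, ENNReal.ofReal (negMulLog (κ.real (p ⁻¹' {t}))) := by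
          rw [Finset.sum_image hinj]
      _ ≤ _ := Finset.sum_le_sum_of_subset (Finset.subset_univ _)
  · exact absurd hfin (lt_irrefl _)

end BaseEntropy

/-! ### From conjugacies on conull sets to globally defined maps. -/

section Isomorphism

theorem nullMeasurableSet_of_compl_null {X : Type*} [MeasurableSpace X] {μ : Measure X}
    {X' : Set X} (h : μ X'ᶜ = 0) : NullMeasurableSet X' μ :=
  (NullMeasurableSet.of_null h).of_compl

theorem comap_val_apply_of_compl_null {X : Type*} [MeasurableSpace X] {μ : Measure X}
    {X' : Set X} (h : μ X'ᶜ = 0) {s : Set X'} (hs : MeasurableSet s) :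
    μ.comap Subtype.val s = μ (Subtype.val '' s) := by
  refine Measure.comap_apply₀ _ _ Subtype.val_injective ?_ hs.nullMeasurableSet
  rintro _ ⟨u, hu, rfl⟩
  rw [Subtype.image_preimage_coe]
  exact (nullMeasurableSet_of_compl_null h).inter hu.nullMeasurableSet

theorem exists_measurable_extension_of_compl_null {X Y : Type*} [MeasurableSpace X]
    [MeasurableSpace Y] [Nonempty Y] {μ : Measure X} {X' : Set X} (h : μ X'ᶜ = 0) {φ : X' → Y}
    (hφ : Measurable φ) :
    ∃ Φ : X → Y, Measurable Φ ∧ ∀ᵐ x ∂μ, ∃ hx : x ∈ X', Φ x = φ ⟨x, hx⟩ := by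
  classical
  -- `X'` need not be measurable, so the map is made constant on a measurable null set covering its
  -- complement.
  set N := toMeasurable μ X'ᶜ
  have hN : MeasurableSet N := measurableSet_toMeasurable _ _
  have hsub : ∀ x ∉ N, x ∈ X' := fun x hx => by
    by_contra h'
    exact hx (subset_toMeasurable μ _ h')
  let y₀ : Y := Classical.arbitrary Y
  refine ⟨fun x => if hx : x ∈ N then y₀ else φ ⟨x, hsub x hx⟩, ?_, ?_⟩
  · refine Measurable.dite (f := fun _ : N => y₀)
      (g := fun x : (Nᶜ : Set X) => φ ⟨x, hsub x x.2⟩) measurable_const ?_ hN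
    exact hφ.comp (measurable_subtype_coe.subtype_mk)
  · have : μ N = 0 := by rw [measure_toMeasurable, h]
    filter_upwards [measure_eq_zero_iff_ae_notMem.1 this] with x hx
    exact ⟨hsub x hx, dif_neg hx⟩

variable {G : Type*} [Group G] {X Y : Type*} [MeasurableSpace X] [MeasurableSpace Y]
  [MulAction G X] [MulAction G Y] {μ : Measure X} {ν : Measure Y}

theorem Isomorphic.symm (h : Isomorphic G μ ν) : Isomorphic G ν μ := by
  obtain ⟨X', Y', φ, hX, hY, hφ, heq⟩ := h
  refine ⟨Y', X', φ.symm, hY, hX, hφ.symm φ, fun g y hy => ?_⟩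
  obtain ⟨hgx, h⟩ := heq g (φ.symm ⟨y, hy⟩) (φ.symm ⟨y, hy⟩).2
  have hy' : g • y = φ ⟨_, hgx⟩ := by
    rw [h]
    simp
  have hgy : g • y ∈ Y' := hy' ▸ (φ ⟨_, hgx⟩).2
  refine ⟨hgy, ?_⟩
  have : (⟨g • y, hgy⟩ : Y') = φ ⟨_, hgx⟩ := Subtype.ext hy'
  rw [this, MeasurableEquiv.symm_apply_apply]

/-- A measurable conjugacy extends to everywhere defined measurable maps. -/
theorem Isomorphic.exists_measurable_maps [Nonempty X] [Nonempty Y] (h : Isomorphic G μ ν)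
    (hμ : ∀ g : G, MeasurePreserving (fun x : X => g • x) μ μ) :
    ∃ (Φ : X → Y) (Ψ : Y → X), MeasurePreserving Φ μ ν ∧ Measurable Ψ ∧
      (∀ᵐ x ∂μ, Ψ (Φ x) = x) ∧ ∀ g : G, ∀ᵐ x ∂μ, Φ (g • x) = g • Φ x := by
  obtain ⟨X', Y', φ, hX, hY, hφ, heq⟩ := h
  obtain ⟨Φ, hΦ, hΦφ⟩ := exists_measurable_extension_of_compl_null hX
    (measurable_subtype_coe.comp φ.measurable)
  obtain ⟨Ψ, hΨ, hΨφ⟩ := exists_measurable_extension_of_compl_null hY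
    (measurable_subtype_coe.comp φ.symm.measurable)
  have hmp : MeasurePreserving Φ μ ν := by
    refine ⟨hΦ, Measure.ext fun t ht => ?_⟩
    rw [Measure.map_apply hΦ ht]
    have h1 := hφ.measure_preimage (measurable_subtype_coe ht).nullMeasurableSet
    rw [comap_val_apply_of_compl_null hX (φ.measurable (measurable_subtype_coe ht)),
      comap_val_apply_of_compl_null hY (measurable_subtype_coe ht),
      Subtype.image_preimage_coe, Set.inter_comm, measure_inter_conull hY] at h1
    rw [← h1]
    refine measure_congr ?_
    filter_upwards [hΦφ] with x ⟨hx, hΦx⟩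
    apply propext
    change Φ x ∈ t ↔ x ∈ Subtype.val '' (φ ⁻¹' (Subtype.val ⁻¹' t))
    rw [hΦx]
    simp [hx]
  refine ⟨Φ, Ψ, hmp, hΨ, ?_, fun g => ?_⟩
  · filter_upwards [hΦφ, hmp.quasiMeasurePreserving.ae hΨφ] with x ⟨hx, hΦx⟩ ⟨hy, hΨx⟩
    rw [hΨx]
    have : (⟨Φ x, hy⟩ : Y') = φ ⟨x, hx⟩ := Subtype.ext hΦx
    simp [this]
  · filter_upwards [hΦφ, (hμ g).quasiMeasurePreserving.ae hΦφ] with x ⟨hx, hΦx⟩ ⟨hgx, hΦgx⟩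
    obtain ⟨_, h⟩ := heq g x hx
    rw [hΦgx, hΦx]
    exact h

end Isomorphism

/-! ### Entropy comparison for isomorphic Bernoulli shifts. -/

section Bernoulli

variable {G : Type*} [Group G] {K₁ K₂ : Type*} [MeasurableSpace K₁] [MeasurableSpace K₂]

theorem measurePreserving_smul_bernoulliMeasure (κ : Measure K₁) [IsProbabilityMeasure κ] (g : G) :
    MeasurePreserving (fun x : BernoulliSpace G K₁ => g • x) (bernoulliMeasure G κ)
      (bernoulliMeasure G κ) :=
  ⟨measurable_pi_lambda (fun (x : G → K₁) f => x (g⁻¹ * f)) fun f => measurable_pi_apply (g⁻¹ * f),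
    infinitePi_map_comp_injective κ (mul_right_injective g⁻¹)⟩

theorem baseEntropy_le_of_isomorphic (hG : IsSofic G) [MeasurableSingletonClass K₁]
    [MeasurableSingletonClass K₂] (κ₁ : Measure K₁) [IsProbabilityMeasure κ₁] (κ₂ : Measure K₂)
    [IsProbabilityMeasure κ₂] (h₁ : baseEntropy κ₁ < ⊤) (h₂ : baseEntropy κ₂ < ⊤)
    (hiso : Isomorphic G (bernoulliMeasure G κ₁) (bernoulliMeasure G κ₂)) :
    baseEntropy κ₁ ≤ baseEntropy κ₂ := by
  classical
  refine baseEntropy_le_of_forall_shannon_le κ₁ h₁ fun T _ _ _ p hp => ?_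
  rw [ENNReal.ofReal_le_iff_le_toReal h₂.ne]
  refine le_of_forall_pos_le_add fun η hη => ?_
  have : Nonempty K₁ := nonempty_of_isProbabilityMeasure κ₁
  have : Nonempty K₂ := nonempty_of_isProbabilityMeasure κ₂
  have : Nonempty (BernoulliSpace G K₁) := inferInstanceAs (Nonempty (G → K₁))
  have : Nonempty (BernoulliSpace G K₂) := inferInstanceAs (Nonempty (G → K₂))
  have : Nonempty T := this.map fun _ => p (Classical.arbitrary K₁)
  obtain ⟨Φ, Ψ, hΦ, hΨ, hΨΦ, heq⟩ := hiso.exists_measurable_maps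
    (measurePreserving_smul_bernoulliMeasure κ₁)
  change (G → K₁) → G → K₂ at Φ
  change (G → K₂) → G → K₁ at Ψ
  set μ := Measure.infinitePi fun _ : G => κ₁
  set ν := Measure.infinitePi fun _ : G => κ₂
  change MeasurePreserving Φ μ ν at hΦ
  change Measurable Ψ at hΨ
  change ∀ᵐ x ∂μ, Ψ (Φ x) = x at hΨΦ
  change ∀ g : G, ∀ᵐ x ∂μ, Φ (fun f => x (g⁻¹ * f)) = fun f => Φ x (g⁻¹ * f) at heq
  obtain ⟨δ, hδ, hdec⟩ := exists_shannon_le_of_decoding hG κ₁ hp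
    (show (0 : ℝ) < η / 3 by positivity)
  have hf : Measurable fun y : G → K₂ => p (Ψ y 1) :=
    hp.comp ((measurable_pi_apply 1).comp hΨ)
  obtain ⟨W, 𝒬, f', h𝒬, hf', hname, hclose⟩ := exists_finite_name_approx ν hf hδ
  -- The finite partition of `K₂` generated by `𝒬`, coded by membership patterns.
  let q : K₂ → 𝒬 → Prop := fun k Q => k ∈ (Q : Set K₂)
  have hq : Measurable q := measurable_pi_lambda _ fun Q => measurable_mem.2 (h𝒬 Q Q.2)
  let name : (G → K₂) → W → 𝒬 → Prop := fun y w => q (y w)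
  have hfac : Function.FactorsThrough f' name := fun y y' hy =>
    hname y y' fun w hw Q hQ => iff_of_eq (congrFun (congrFun hy ⟨w, hw⟩) ⟨Q, hQ⟩)
  -- The decoder; its default on patterns that never occur is irrelevant.
  let A : (W → 𝒬 → Prop) → T := Function.extend name f' fun _ => Classical.arbitrary T
  have hA : ∀ y, A (name y) = f' y := fun y => hfac.extend_apply _ y
  let b : (G → K₁) → 𝒬 → Prop := fun x => q (Φ x 1)
  have hb : Measurable b := hq.comp ((measurable_pi_apply 1).comp hΦ.measurable)
  have herr : μ.real {x | A (fun w => b fun f => x (w * f)) ≠ p (x 1)} < δ := by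
    have h1 : μ.real {x | A (fun w => b fun f => x (w * f)) ≠ p (x 1)} =
        μ.real (Φ ⁻¹' {y | f' y ≠ p (Ψ y 1)}) := by
      refine measureReal_congr ?_
      -- The shift by `g` reads coordinate `g⁻¹ * f`, so equivariance is applied at `w⁻¹`; finitely
      -- many null sets are discarded.
      have hall : ∀ᵐ x ∂μ, ∀ w ∈ W, Φ (fun f => x (w * f)) = fun f => Φ x (w * f) := by
        refine (Filter.eventually_all_finset W).2 fun w _ => ?_
        simpa using heq w⁻¹
      filter_upwards [hall, hΨΦ] with x hx hΨx
      apply propext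
      change A (fun w => b fun f => x (w * f)) ≠ p (x 1) ↔ f' (Φ x) ≠ p (Ψ (Φ x) 1)
      have h2 : (fun w : W => b fun f => x (w * f)) = name (Φ x) := by
        funext w
        simp only [b, name, hx w w.2, mul_one]
      rw [hΨx, h2, hA]
    have hm : MeasurableSet {y | f' y ≠ p (Ψ y 1)} := by
      have : {y | f' y ≠ p (Ψ y 1)} = (fun y => (f' y, p (Ψ y 1))) ⁻¹' {z | z.1 ≠ z.2} := rfl
      rw [this]
      exact (hf'.prodMk hf) (Set.toFinite _).measurableSet
    rw [h1, hΦ.measureReal_preimage hm.nullMeasurableSet]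
    exact hclose
  have h3 := hdec hb W A herr
  have h4 : shannon μ b = shannon κ₂ q := by
    refine shannon_comp_of_map_eq hb hq ?_
    have h5 := (measurePreserving_eval_infinitePi (fun _ : G => κ₂) 1).comp hΦ
    rw [← h5.map_eq, Measure.map_map hq h5.measurable]
    rfl
  have h6 := (ENNReal.ofReal_le_iff_le_toReal h₂.ne).1 (ofReal_shannon_le_baseEntropy κ₂ q)
  linarith

end Bernoulli

end SoficEntropy

theorem theorem1 {G : Type*} [Group G] [Countable G] (hG : SoficEntropy.IsSofic G)
    {K₁ K₂ : Type*} [MeasurableSpace K₁] [StandardBorelSpace K₁]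
    [MeasurableSpace K₂] [StandardBorelSpace K₂]
    (κ₁ : Measure K₁) [IsProbabilityMeasure κ₁] (κ₂ : Measure K₂) [IsProbabilityMeasure κ₂]
    (hfin : SoficEntropy.baseEntropy κ₁ + SoficEntropy.baseEntropy κ₂ < ⊤)
    (hiso : SoficEntropy.Isomorphic G
      (SoficEntropy.bernoulliMeasure G κ₁) (SoficEntropy.bernoulliMeasure G κ₂)) :
    SoficEntropy.baseEntropy κ₁ = SoficEntropy.baseEntropy κ₂ := by
  have h₁ := (self_le_add_right _ _).trans_lt hfin
  have h₂ := (self_le_add_left _ _).trans_lt hfin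
  exact le_antisymm (SoficEntropy.baseEntropy_le_of_isomorphic hG κ₁ κ₂ h₁ h₂ hiso)
    (SoficEntropy.baseEntropy_le_of_isomorphic hG κ₂ κ₁ h₂ h₁ hiso.symm)
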